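/- Let $G=(V,E)$ be a finite undirected simple graph and let $\mathbf c=(c_{xy})_{xy\in E}$ be nonnegative real numbers (conductances). Let $\nu$ be the uniform probability measure on the set $S$ of permutations of $V$, write $\nu[g]$ for the expectation of $g:S\to\mathbb R$ under $\nu$, and for $f:S\to\mathbb R$ put $$(\nabla_{xy}f)(\eta)=f(\eta\,\tau_{xy})-f(\eta),$$ where $\tau_{xy}$ is the transposition of $x$ and $y$ (the identity if $x=y$). The interchange process on $(G,\mathbf c)$ has generator $(\mathcal L^{\rm IP}f)(\eta)=\sum_{xy\in E}c_{xy}(\nabla_{xy}f)(\eta)$ and Dirichlet energy $\mathcal E^{\rm IP}(f)=\nu\big[f\,(-\mathcal L^{\rm IP}f)\big]=\frac12\sum_{xy\in E}c_{xy}\,\nu[(\nabla_{xy}f)^2]$. The effective resistance $R_{\rm eff}(x,y)\in[0,\infty]$ is defined by $$R_{\rm eff}(x,y)^{-1}=\inf\Big\{\sum_{zw\in E}c_{zw}[h(z)-h(w)]^2 \;:\; h:V\to\mathbb R,\ h(x)=1,\ h(y)=0\Big\}$$ (so $R_{\rm eff}(x,x)=0$, the infimum of the empty set being $\infty$). Let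 $x,y\in V$ be joined by a path of edges with positive conductance (this holds for all $x,y\in V$ if $G$ is connected and all conductances are positive). Then $R_{\rm eff}(x,y)<\infty$, and for every $f:S\to\mathbb R$, $$\frac12\,\nu\big[(\nabla_{xy}f)^2\big]\;\le\;R_{\rm eff}(x,y)\,\mathcal E^{\rm IP}(f).$$ -/

import Mathlib

open scoped ENNReal BigOperators

namespace MovingParticle

noncomputable section

/-- The random-walk (electrical) Dirichlet energy `∑_{zw ∈ E} c_{zw} (h z - h w)²` of a function
on the vertices. The sum is over undirected edges, each counted once. -/
def electricEnergy {V : Type*} [Fintype V] [DecidableEq V] (G : SimpleGraph V)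
    [DecidableRel G.Adj] (c : Sym2 V → ℝ) (h : V → ℝ) : ℝ :=
  ∑ e ∈ G.edgeFinset, c e * Sym2.lift ⟨fun z w => (h z - h w) ^ 2, fun z w => by ring⟩ e

/-- The effective resistance, given by
`R_eff(x,y)⁻¹ = inf { ∑_{zw ∈ E} c_{zw} (h z - h w)² | h x = 1, h y = 0 }`, with the infimum and
the inverse taken in `[0, ∞]`. For `x = y` no `h` is admissible, the infimum is `∞`, and the
resistance is `0`. -/
def effectiveResistance {V : Type*} [Fintype V] [DecidableEq V] (G : SimpleGraph V)
    [DecidableRel G.Adj] (c : Sym2 V → ℝ) (x y : V) : ℝ≥0∞ :=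
  (⨅ (h : V → ℝ) (_ : h x = 1 ∧ h y = 0), ENNReal.ofReal (electricEnergy G c h))⁻¹

/-- `(∇_{xy} f)(η) = f(η τ_{xy}) - f(η)`, with `τ_{xy}` the transposition of `x` and `y`. -/
def swapDiff {V : Type*} [DecidableEq V] (x y : V) (f : Equiv.Perm V → ℝ)
    (η : Equiv.Perm V) : ℝ :=
  f (η * Equiv.swap x y) - f η

/-- The expectation `ν[g]` under the uniform probability measure `ν` on the permutations. -/
def uniformMean {V : Type*} [Fintype V] [DecidableEq V] (g : Equiv.Perm V → ℝ) : ℝ :=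
  𝔼 η : Equiv.Perm V, g η

/-- The generator of the interchange process,
`(L f)(η) = ∑_{xy ∈ E} c_{xy} (f(η τ_{xy}) - f(η))`. -/
def interchangeGenerator {V : Type*} [Fintype V] [DecidableEq V] (G : SimpleGraph V)
    [DecidableRel G.Adj] (c : Sym2 V → ℝ) (f : Equiv.Perm V → ℝ) (η : Equiv.Perm V) : ℝ :=
  ∑ e ∈ G.edgeFinset,
    c e * Sym2.lift ⟨fun x y => swapDiff x y f η,
      fun x y => by simp only [swapDiff, Equiv.swap_comm]⟩ e

/-- The Dirichlet energy of the interchange process, `E(f) = ν[f · (-L f)]`. -/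
def interchangeEnergy {V : Type*} [Fintype V] [DecidableEq V] (G : SimpleGraph V)
    [DecidableRel G.Adj] (c : Sym2 V → ℝ) (f : Equiv.Perm V → ℝ) : ℝ :=
  uniformMean fun η => f η * -interchangeGenerator G c f η

end

end MovingParticle

/-! Write φ(g) = ∑ f(η) f(ηg), a positive definite function on the permutations, and D(x,y) = φ(1) -
φ((x y)). Up to the factor 1/|S|, D(x,y) is the left side of the claim, and 𝓔(f) is the sum of
c_{zw} D(z,w) over edges. The claim follows from eliminating the other vertices one at a time by
star-mesh transformations: each preserves the electrical energy once the potential is extended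
harmonically, and does not increase the D-energy.

The latter is the octopus inequality, `octopus_correlation`: if ∑ c_i = 0 and only c_o may be
negative, then X = ∑ c_i c_j (i j) satisfies φ(X) ≥ 0. Here X is self-adjoint, so φ(X²) ≥ 0, and
expanding X² gives 2(∑ c_i²) φ(X) = φ(X²) + (sum of gaps of products of two transpositions). By
`sum_quadGap` that last sum is -1/3 times a weighted sum of `quadGap`, which `sum_quadGap_nonpos`
reduces to the five-letter inequality `quadGap_le`. The local inequalities hold because explicit
group algebra elements m satisfy m*m = 12m. -/

namespace MovingParticle

/-! ### Positive definiteness and group algebra certificates -/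

section Correlation

variable {G : Type*} [Group G] [Fintype G]

/-- The unnormalised correlation `∑ η, f η * f (η * g)`. -/
def correlation (f : G → ℝ) (g : G) : ℝ := ∑ η, f η * f (η * g)

theorem sum_mul_eq_correlation (f : G → ℝ) (g h : G) :
    ∑ η, f (η * g) * f (η * h) = correlation f (g⁻¹ * h) := by
  rw [correlation, ← Equiv.sum_comp (Equiv.mulRight g⁻¹)]
  simp [mul_assoc]

theorem correlation_inv (f : G → ℝ) (g : G) : correlation f g⁻¹ = correlation f g := by
  rw [← mul_one g⁻¹, ← sum_mul_eq_correlation, correlation]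
  simp [mul_comm]

/-- Correlations are positive definite functions. -/
theorem correlation_sum_nonneg (f : G → ℝ) {ι : Type*} [Fintype ι] (a : ι → ℝ) (g : ι → G) :
    0 ≤ ∑ x, ∑ y, a x * a y * correlation f ((g x)⁻¹ * g y) := by
  have h : ∑ x, ∑ y, a x * a y * correlation f ((g x)⁻¹ * g y)
      = ∑ η, (∑ x, a x * f (η * g x)) ^ 2 := by
    simp_rw [← sum_mul_eq_correlation, sq, Finset.sum_mul_sum, Finset.mul_sum]
    symm
    rw [Finset.sum_comm]
    refine Finset.sum_congr rfl fun x _ => ?_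
    rw [Finset.sum_comm]
    refine Finset.sum_congr rfl fun y _ => Finset.sum_congr rfl fun η _ => ?_
    ring
  rw [h]
  positivity

theorem sum_list_eq_sum_coeff {H : Type*} [Fintype H] [DecidableEq H] (L : List (ℤ × H))
    (F : H → ℝ) :
    (L.map fun x => (x.1 : ℝ) * F x.2).sum
      = ∑ k, (((L.map fun x => if x.2 = k then x.1 else 0).sum : ℤ) : ℝ) * F k := by
  induction L with
  | nil => simp
  | cons x L ih =>
    simp only [List.map_cons, List.sum_cons, ih, Int.cast_add, add_mul, Finset.sum_add_distrib]
    simp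

/-- A group algebra element `m` with `m* m = K m`, `K > 0`, is positive. -/
theorem correlation_list_nonneg {H : Type*} [Group H] [Fintype H] [DecidableEq H] (ψ : H →* G)
    (L : List (ℤ × H)) (m : H → ℤ) {K : ℤ} (hK : 0 < K)
    (hm : ∀ k, (L.map fun x => if x.2 = k then x.1 else 0).sum = m k)
    (hconv : ∀ k, (L.map fun x => x.1 * m (x.2 * k)).sum = K * m k) (f : G → ℝ) :
    0 ≤ (L.map fun x => (x.1 : ℝ) * correlation f (ψ x.2)).sum := by
  have hpos := correlation_sum_nonneg f (fun h : H => (m h : ℝ)) ψ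
  have hL := sum_list_eq_sum_coeff L
  simp_rw [hm] at hL
  rw [hL fun h => correlation f (ψ h)]
  -- Substituting h = gk turns the positive quadratic form into φ(m*m), which is K φ(m).
  have key : ∑ g, ∑ h, (m g : ℝ) * m h * correlation f ((ψ g)⁻¹ * ψ h)
      = K * ∑ k, (m k : ℝ) * correlation f (ψ k) := by
    calc _ = ∑ g, ∑ k, (m g : ℝ) * m (g * k) * correlation f (ψ k) := by
          refine Finset.sum_congr rfl fun g _ => ?_
          rw [← Equiv.sum_comp (Equiv.mulLeft g)]
          simp
      _ = ∑ k, (∑ g, (m g : ℝ) * m (g * k)) * correlation f (ψ k) := by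
          rw [Finset.sum_comm]
          simp_rw [Finset.sum_mul]
      _ = _ := by
          rw [Finset.mul_sum]
          refine Finset.sum_congr rfl fun k _ => ?_
          rw [← hL fun g => (m (g * k) : ℝ), ← mul_assoc]
          congr 1
          have := congrArg (Int.cast : ℤ → ℝ) (hconv k)
          rw [Int.cast_list_sum, List.map_map] at this
          push_cast at this
          rw [← this]
          congr 1
          refine List.map_congr_left fun x _ => ?_
          simp
  rw [key] at hpos
  exact nonneg_of_mul_nonneg_right hpos (by exact_mod_cast hK)

end Correlation

/-! ### Finite certificates on four and five letters -/

theorem viaEmbeddingHom_swap {α β : Type*} [DecidableEq α] [DecidableEq β] (e : α ↪ β) (a b : α) :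
    Equiv.Perm.viaEmbeddingHom e (Equiv.swap a b) = Equiv.swap (e a) (e b) := by
  ext x
  rw [Equiv.Perm.viaEmbeddingHom_apply]
  by_cases hx : x ∈ Set.range e
  · obtain ⟨y, rfl⟩ := hx
    rw [Equiv.Perm.viaEmbedding_apply, e.injective.swap_apply]
  · rw [Equiv.Perm.viaEmbedding_apply_of_notMem _ _ _ hx, Equiv.swap_apply_of_ne_of_ne]
    · rintro rfl; exact hx ⟨_, rfl⟩
    · rintro rfl; exact hx ⟨_, rfl⟩

/-- Twelve times the projection onto the nontrivial characters of the alternating group on four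
letters. -/
def alternatingTerms : List (ℤ × Equiv.Perm (Fin 4)) :=
  [(2, 1), (2, Equiv.swap 0 1 * Equiv.swap 2 3), (2, Equiv.swap 0 2 * Equiv.swap 1 3),
   (2, Equiv.swap 0 3 * Equiv.swap 1 2),
   (-1, Equiv.swap 0 1 * Equiv.swap 1 2), (-1, Equiv.swap 0 2 * Equiv.swap 2 1),
   (-1, Equiv.swap 0 1 * Equiv.swap 1 3), (-1, Equiv.swap 0 3 * Equiv.swap 3 1),
   (-1, Equiv.swap 0 2 * Equiv.swap 2 3), (-1, Equiv.swap 0 3 * Equiv.swap 3 2),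
   (-1, Equiv.swap 1 2 * Equiv.swap 2 3), (-1, Equiv.swap 1 3 * Equiv.swap 3 2)]

/-- Half of `∑ D_q - D_0`, where `D_q` is the element of `alternatingTerms` for the four letters
other than `q`, and `q` runs over the nonzero letters. -/
def octopusTerms : List (ℤ × Equiv.Perm (Fin 5)) :=
  [(3, 1), (-1, Equiv.swap 1 2 * Equiv.swap 3 4), (-1, Equiv.swap 1 3 * Equiv.swap 2 4),
   (-1, Equiv.swap 1 4 * Equiv.swap 2 3), (1, Equiv.swap 0 1 * Equiv.swap 2 3),
   (1, Equiv.swap 0 1 * Equiv.swap 2 4), (1, Equiv.swap 0 1 * Equiv.swap 3 4),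
   (1, Equiv.swap 0 2 * Equiv.swap 1 3), (1, Equiv.swap 0 2 * Equiv.swap 1 4),
   (1, Equiv.swap 0 2 * Equiv.swap 3 4), (1, Equiv.swap 0 3 * Equiv.swap 1 2),
   (1, Equiv.swap 0 3 * Equiv.swap 1 4), (1, Equiv.swap 0 3 * Equiv.swap 2 4),
   (1, Equiv.swap 0 4 * Equiv.swap 1 2), (1, Equiv.swap 0 4 * Equiv.swap 1 3),
   (1, Equiv.swap 0 4 * Equiv.swap 2 3), (-1, Equiv.swap 0 1 * Equiv.swap 1 2),
   (-1, Equiv.swap 0 1 * Equiv.swap 1 3), (-1, Equiv.swap 0 1 * Equiv.swap 1 4),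
   (-1, Equiv.swap 0 2 * Equiv.swap 2 1), (-1, Equiv.swap 0 2 * Equiv.swap 2 3),
   (-1, Equiv.swap 0 2 * Equiv.swap 2 4), (-1, Equiv.swap 0 3 * Equiv.swap 3 1),
   (-1, Equiv.swap 0 3 * Equiv.swap 3 2), (-1, Equiv.swap 0 3 * Equiv.swap 3 4),
   (-1, Equiv.swap 0 4 * Equiv.swap 4 1), (-1, Equiv.swap 0 4 * Equiv.swap 4 2),
   (-1, Equiv.swap 0 4 * Equiv.swap 4 3)]

/-- The decimal number with the given digits. -/
def digitCode (a b c d e : Fin 5) : ℕ :=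
  (((10 * a.1 + b.1) * 10 + c.1) * 10 + d.1) * 10 + e.1

theorem digitCode_inj {a b c d e a' b' c' d' e' : Fin 5}
    (h : digitCode a b c d e = digitCode a' b' c' d' e') :
    a = a' ∧ b = b' ∧ c = c' ∧ d = d' ∧ e = e' := by
  simp only [digitCode] at h
  simp only [Fin.ext_iff]
  omega

/-- The coefficients of `octopusTerms`, indexed by the values of a permutation. -/
def octopusTable (n : ℕ) : ℤ :=
  if n ∈ [10243, 10324, 10432, 21043, 23014, 24031, 31402, 32104,
      34201, 41320, 42130, 43210] then 1
  else if n ∈ [2143, 3412, 4321, 12034, 13204, 14230, 20134, 21304,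
      21430, 30214, 31024, 31240, 40231, 41032, 41203] then -1
  else if n = 1234 then 3 else 0

/-- Coding permutations by their digits (a leading 0 disappears, so the identity is 1234) reduces
the kernel computation to natural number arithmetic over tuples of values. -/
theorem sum_octopusTerms : ∀ a b c d e : Fin 5, [a, b, c, d, e].Nodup →
    (octopusTerms.map fun x =>
      if digitCode (x.2 0) (x.2 1) (x.2 2) (x.2 3) (x.2 4) = digitCode a b c d e then x.1
      else 0).sum = octopusTable (digitCode a b c d e) := by
  decide +kernel

theorem convolution_octopusTerms : ∀ a b c d e : Fin 5, [a, b, c, d, e].Nodup →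
    (octopusTerms.map fun x =>
      x.1 * octopusTable (digitCode (x.2 a) (x.2 b) (x.2 c) (x.2 d) (x.2 e))).sum
      = 12 * octopusTable (digitCode a b c d e) := by
  decide +kernel

theorem convolution_alternatingTerms : ∀ k,
    (alternatingTerms.map fun x =>
      x.1 * (alternatingTerms.map fun y => if y.2 = x.2 * k then y.1 else 0).sum).sum
      = 12 * (alternatingTerms.map fun y => if y.2 = k then y.1 else 0).sum := by
  decide +kernel

variable {V : Type*} [Fintype V] [DecidableEq V]

theorem alternating_correlation_nonneg (f : Equiv.Perm V → ℝ) (v : Fin 4 ↪ V) :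
    0 ≤ (alternatingTerms.map fun x =>
      (x.1 : ℝ) * correlation f (Equiv.Perm.viaEmbeddingHom v x.2)).sum :=
  correlation_list_nonneg _ _ _ (by norm_num) (fun _ => rfl) convolution_alternatingTerms f

theorem octopus_correlation_nonneg (f : Equiv.Perm V → ℝ) (v : Fin 5 ↪ V) :
    0 ≤ (octopusTerms.map fun x =>
      (x.1 : ℝ) * correlation f (Equiv.Perm.viaEmbeddingHom v x.2)).sum := by
  have hnodup (k : Equiv.Perm (Fin 5)) : [k 0, k 1, k 2, k 3, k 4].Nodup :=
    List.Nodup.map (l := [0, 1, 2, 3, 4]) k.injective (by decide)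
  refine correlation_list_nonneg _ octopusTerms
    (fun k => octopusTable (digitCode (k 0) (k 1) (k 2) (k 3) (k 4))) (K := 12) (by norm_num)
    (fun k => ?_) (fun k => convolution_octopusTerms _ _ _ _ _ (hnodup k)) f
  rw [← sum_octopusTerms _ _ _ _ _ (hnodup k)]
  congr 1
  refine List.map_congr_left fun x _ => if_congr ⟨?_, ?_⟩ rfl rfl
  · rintro rfl; rfl
  · intro h
    obtain ⟨h0, h1, h2, h3, h4⟩ := digitCode_inj h
    ext i
    fin_cases i <;> simp_all

end MovingParticle

/-! ### Local inequalities for gaps -/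

namespace MovingParticle

variable {V : Type*} [Fintype V] [DecidableEq V]

/-- The quadratic form of `1 - (i j)(j k)` for distinct `i, j, k`. -/
def cycleGap (f : Equiv.Perm V → ℝ) (i j k : V) : ℝ :=
  if [i, j, k].Nodup then
    correlation f 1 - correlation f (Equiv.swap i j * Equiv.swap j k) else 0

/-- The quadratic form of `1 - (i j)(k l)` for distinct `i, j, k, l`. -/
def pairGap (f : Equiv.Perm V → ℝ) (i j k l : V) : ℝ :=
  if [i, j, k, l].Nodup then
    correlation f 1 - correlation f (Equiv.swap i j * Equiv.swap k l) else 0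

/-- The quadratic form of half of the element `alternatingTerms` on the letters `i, j, k, l`. -/
def quadGap (f : Equiv.Perm V → ℝ) (i j k l : V) : ℝ :=
  if [i, j, k, l].Nodup then
    cycleGap f i j k + cycleGap f i j l + cycleGap f i k l + cycleGap f j k l
      - pairGap f i j k l - pairGap f i k j l - pairGap f i l j k else 0

theorem cycleGap_rotate (f : Equiv.Perm V → ℝ) (i j k : V) :
    cycleGap f i j k = cycleGap f j k i := by
  have h : [i, j, k].Nodup ↔ [j, k, i].Nodup := by simp; tauto
  unfold cycleGap
  refine ite_congr (propext h) (fun hn => ?_) fun _ => rfl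
  congr 2
  simp only [List.nodup_cons, List.mem_cons, List.not_mem_nil, or_false, not_or] at hn
  ext x
  simp only [Equiv.Perm.mul_apply, Equiv.swap_apply_def]
  grind

/-- Reversal inverts the three-cycle, and correlations are invariant under inversion. With rotation
this gives full symmetry. -/
theorem cycleGap_reverse (f : Equiv.Perm V → ℝ) (i j k : V) :
    cycleGap f i j k = cycleGap f k j i := by
  have h : [i, j, k].Nodup ↔ [k, j, i].Nodup := by simp; tauto
  unfold cycleGap
  refine ite_congr (propext h) (fun _ => ?_) fun _ => rfl
  rw [← correlation_inv f (_ * _)]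
  simp [Equiv.swap_comm]

theorem cycleGap_swap_left (f : Equiv.Perm V → ℝ) (i j k : V) :
    cycleGap f i j k = cycleGap f j i k := by
  rw [cycleGap_reverse, cycleGap_rotate]

theorem cycleGap_swap_right (f : Equiv.Perm V → ℝ) (i j k : V) :
    cycleGap f i j k = cycleGap f i k j := by
  rw [cycleGap_reverse, ← cycleGap_rotate]

theorem pairGap_swap_left (f : Equiv.Perm V → ℝ) (i j k l : V) :
    pairGap f i j k l = pairGap f j i k l := by
  have h : [i, j, k, l].Nodup ↔ [j, i, k, l].Nodup := by simp; tauto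
  unfold pairGap
  refine ite_congr (propext h) (fun _ => ?_) fun _ => rfl
  rw [Equiv.swap_comm i j]

theorem pairGap_swap_right (f : Equiv.Perm V → ℝ) (i j k l : V) :
    pairGap f i j k l = pairGap f i j l k := by
  have h : [i, j, k, l].Nodup ↔ [i, j, l, k].Nodup := by simp; tauto
  unfold pairGap
  refine ite_congr (propext h) (fun _ => ?_) fun _ => rfl
  rw [Equiv.swap_comm k l]

theorem pairGap_swap_pairs (f : Equiv.Perm V → ℝ) (i j k l : V) :
    pairGap f i j k l = pairGap f k l i j := by
  have h : [i, j, k, l].Nodup ↔ [k, l, i, j].Nodup := by simp; tauto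
  unfold pairGap
  refine ite_congr (propext h) (fun _ => ?_) fun _ => rfl
  rw [← correlation_inv f (_ * _)]
  simp

theorem quadGap_swap_first (f : Equiv.Perm V → ℝ) (i j k l : V) :
    quadGap f i j k l = quadGap f j i k l := by
  have h : [i, j, k, l].Nodup ↔ [j, i, k, l].Nodup := by simp; tauto
  unfold quadGap
  refine ite_congr (propext h) (fun _ => ?_) fun _ => rfl
  rw [cycleGap_swap_left f i j k, cycleGap_swap_left f i j l, pairGap_swap_left f i j,
    pairGap_swap_pairs f i k, pairGap_swap_pairs f i l]
  rw [pairGap_swap_left f j l, pairGap_swap_left f j k, pairGap_swap_pairs f l j,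
    pairGap_swap_pairs f k j, pairGap_swap_left f i k, pairGap_swap_left f i l,
    pairGap_swap_pairs f k i, pairGap_swap_pairs f l i]
  ring

theorem quadGap_swap_middle (f : Equiv.Perm V → ℝ) (i j k l : V) :
    quadGap f i j k l = quadGap f i k j l := by
  have h : [i, j, k, l].Nodup ↔ [i, k, j, l].Nodup := by simp; tauto
  unfold quadGap
  refine ite_congr (propext h) (fun _ => ?_) fun _ => rfl
  rw [cycleGap_swap_right f i j k, cycleGap_swap_left f j k l, pairGap_swap_right f i l j k]
  ring

theorem quadGap_swap_last (f : Equiv.Perm V → ℝ) (i j k l : V) :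
    quadGap f i j k l = quadGap f i j l k := by
  have h : [i, j, k, l].Nodup ↔ [i, j, l, k].Nodup := by simp; tauto
  unfold quadGap
  refine ite_congr (propext h) (fun _ => ?_) fun _ => rfl
  rw [cycleGap_swap_right f i k l, cycleGap_swap_right f j k l, pairGap_swap_right f i j k l]
  ring

theorem correlation_three_cycle (f : Equiv.Perm V → ℝ) {i j k : V} (h : [i, j, k].Nodup) :
    correlation f (Equiv.swap i j * Equiv.swap j k) = correlation f 1 - cycleGap f i j k := by
  simp [cycleGap, h]

theorem correlation_swap_pair (f : Equiv.Perm V → ℝ) {i j k l : V} (h : [i, j, k, l].Nodup) :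
    correlation f (Equiv.swap i j * Equiv.swap k l) = correlation f 1 - pairGap f i j k l := by
  simp [pairGap, h]

theorem quadGap_nonneg (f : Equiv.Perm V → ℝ) (i j k l : V) : 0 ≤ quadGap f i j k l := by
  by_cases hn : [i, j, k, l].Nodup
  swap
  · simp [quadGap, hn]
  have hinj : Function.Injective ![i, j, k, l] := by
    rwa [← List.nodup_ofFn]
  have h := alternating_correlation_nonneg f ⟨_, hinj⟩
  rw [quadGap, if_pos hn]
  simp only [List.nodup_cons, List.mem_cons, List.not_mem_nil, or_false, not_or] at hn
  obtain ⟨⟨hij, hik, hil⟩, ⟨hjk, hjl⟩, hkl, -⟩ := hn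
  simp [alternatingTerms, viaEmbeddingHom_swap, correlation_three_cycle, correlation_swap_pair,
    hij, hik, hil, hjk, hjl, hkl, Ne.symm hjk, Ne.symm hjl, Ne.symm hkl] at h
  linarith [cycleGap_swap_right f i j k, cycleGap_swap_right f i j l, cycleGap_swap_right f i k l,
    cycleGap_swap_right f j k l]

/-- The right side minus the left is exactly the form of `octopusTerms` on these letters, with `o`
as letter 0. -/
theorem quadGap_le (f : Equiv.Perm V → ℝ) {o i j k l : V} (hn : [o, i, j, k, l].Nodup) :
    quadGap f i j k l ≤
      quadGap f o i j k + quadGap f o i j l + quadGap f o i k l + quadGap f o j k l := by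
  have hinj : Function.Injective ![o, i, j, k, l] := by
    rwa [← List.nodup_ofFn]
  have h := octopus_correlation_nonneg f ⟨_, hinj⟩
  simp only [List.nodup_cons, List.mem_cons, List.not_mem_nil, or_false, not_or] at hn
  obtain ⟨⟨hoi, hoj, hok, hol⟩, ⟨hij, hik, hil⟩, ⟨hjk, hjl⟩, hkl, -⟩ := hn
  simp [octopusTerms, viaEmbeddingHom_swap, correlation_three_cycle, correlation_swap_pair,
    hij, hik, hil, hjk, hjl, hkl, Ne.symm hij, Ne.symm hik, Ne.symm hil, Ne.symm hjk, Ne.symm hjl, Ne.symm hkl,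
    hoi, hoj, hok, hol] at h
  simp only [quadGap, List.nodup_cons, List.mem_cons, List.not_mem_nil, or_false,
    hoi, hoj, hok, hol, hij, hik, hil, hjk, hjl, hkl, not_false_eq_true, and_true, if_true,
    List.nodup_nil]
  linarith [cycleGap_swap_right f o i j, cycleGap_swap_right f o i k, cycleGap_swap_right f o i l,
    cycleGap_swap_right f o j k, cycleGap_swap_right f o j l, cycleGap_swap_right f o k l]

end MovingParticle

/-! ### Sums over quadruples -/

namespace MovingParticle

section QuadrupleSums

variable {V : Type*}

theorem sum_quad_swap_first (S : Finset V) (A : V → V → V → V → ℝ) :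
    ∑ i ∈ S, ∑ j ∈ S, ∑ k ∈ S, ∑ l ∈ S, A i j k l
      = ∑ i ∈ S, ∑ j ∈ S, ∑ k ∈ S, ∑ l ∈ S, A j i k l :=
  Finset.sum_comm

theorem sum_quad_swap_middle (S : Finset V) (A : V → V → V → V → ℝ) :
    ∑ i ∈ S, ∑ j ∈ S, ∑ k ∈ S, ∑ l ∈ S, A i j k l
      = ∑ i ∈ S, ∑ j ∈ S, ∑ k ∈ S, ∑ l ∈ S, A i k j l :=
  Finset.sum_congr rfl fun _ _ => Finset.sum_comm

theorem sum_quad_swap_last (S : Finset V) (A : V → V → V → V → ℝ) :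
    ∑ i ∈ S, ∑ j ∈ S, ∑ k ∈ S, ∑ l ∈ S, A i j k l
      = ∑ i ∈ S, ∑ j ∈ S, ∑ k ∈ S, ∑ l ∈ S, A i j l k :=
  Finset.sum_congr rfl fun _ _ => Finset.sum_congr rfl fun _ _ => Finset.sum_comm

/-- By symmetry, terms with a repeated index vanish, so `o` occurs at most once, in any of four
positions. -/
theorem sum_quad_eq_erase [Fintype V] [DecidableEq V] (o : V) (A : V → V → V → V → ℝ)
    (h1 : ∀ i j k l, A i j k l = A j i k l) (h2 : ∀ i j k l, A i j k l = A i k j l)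
    (h3 : ∀ i j k l, A i j k l = A i j l k) (h0 : ∀ i k l, A i i k l = 0) :
    ∑ i, ∑ j, ∑ k, ∑ l, A i j k l
      = ∑ i ∈ Finset.univ.erase o, ∑ j ∈ Finset.univ.erase o, ∑ k ∈ Finset.univ.erase o,
          ∑ l ∈ Finset.univ.erase o, A i j k l
        + 4 * ∑ i ∈ Finset.univ.erase o, ∑ j ∈ Finset.univ.erase o,
          ∑ k ∈ Finset.univ.erase o, A o i j k := by
  obtain ⟨S, hS⟩ : ∃ S, S = Finset.univ.erase o := ⟨_, rfl⟩
  have hsum (g : V → ℝ) : ∑ i, g i = g o + ∑ i ∈ S, g i := by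
    rw [hS, Finset.add_sum_erase _ _ (Finset.mem_univ o)]
  have s2 (i j k) : A i o j k = A o i j k := h1 ..
  have s3 (i j k) : A i j o k = A o i j k := by rw [h2, h1]
  have s4 (i j k) : A i j k o = A o i j k := by rw [h3, h2, h1]
  rw [← hS]
  simp_rw [hsum, Finset.sum_add_distrib, s4, s3, s2, h0]
  simp only [Finset.sum_const_zero]
  ring

end QuadrupleSums

variable {V : Type*} [Fintype V] [DecidableEq V]

/-- The quadratic form of `1 - (i j)(k l)` for `i ≠ j` and `k ≠ l`. -/
def edgeGap (f : Equiv.Perm V → ℝ) (i j k l : V) : ℝ :=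
  if i ≠ j ∧ k ≠ l then correlation f 1 - correlation f (Equiv.swap i j * Equiv.swap k l) else 0

/-- Two transpositions sharing one letter multiply to a three-cycle; if they share both, the product
is the identity and every gap vanishes. -/
theorem edgeGap_eq (f : Equiv.Perm V → ℝ) (i j k l : V) :
    edgeGap f i j k l = pairGap f i j k l
      + (if i = k then cycleGap f i j l else 0) + (if i = l then cycleGap f i j k else 0)
      + (if j = k then cycleGap f i j l else 0) + (if j = l then cycleGap f i j k else 0) := by
  by_cases hij : i = j
  · subst hij
    simp [edgeGap, pairGap, cycleGap]
  by_cases hkl : k = l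
  · subst hkl
    by_cases hik : i = k <;> by_cases hjk : j = k <;> simp_all [edgeGap, pairGap, cycleGap]
  by_cases hik : i = k
  · subst hik
    by_cases hjl : j = l
    · subst hjl
      simp_all [edgeGap, pairGap, cycleGap]
    · rw [cycleGap_swap_left f i j l]
      simp only [edgeGap, cycleGap, pairGap]
      simp [hij, hkl, hjl, Ne.symm hij, Equiv.swap_comm i j]
  by_cases hil : i = l
  · subst hil
    by_cases hjk : j = k
    · subst hjk
      simp_all [edgeGap, pairGap, cycleGap, Equiv.swap_comm i j]
    · rw [cycleGap_swap_left f i j k]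
      simp only [edgeGap, cycleGap, pairGap]
      simp [hij, hik, hjk, hkl, Ne.symm hij, Equiv.swap_comm i j, Equiv.swap_comm k i]
  by_cases hjk : j = k
  · subst hjk
    simp [edgeGap, cycleGap, pairGap, hij, hkl, hil]
  by_cases hjl : j = l
  · subst hjl
    simp [edgeGap, cycleGap, pairGap, hij, hkl, hik, hjk, Equiv.swap_comm j k]
  simp [edgeGap, pairGap, *]

theorem edgeGap_add_correlation (f : Equiv.Perm V → ℝ) (i j k l : V) :
    edgeGap f i j k l + correlation f (Equiv.swap i j * Equiv.swap k l)
      = correlation f 1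
        + (if i = j then correlation f (Equiv.swap k l) - correlation f 1 else 0)
        + (if k = l then correlation f (Equiv.swap i j) - correlation f 1 else 0) := by
  have h1 : Equiv.refl V = (1 : Equiv.Perm V) := rfl
  by_cases hij : i = j <;> by_cases hkl : k = l <;> simp [edgeGap, hij, hkl, h1]

theorem ite_cycleGap_eq (f : Equiv.Perm V → ℝ) (i j k l : V) :
    (if [i, j, k, l].Nodup then cycleGap f i j k else 0) = cycleGap f i j k
      - (if i = l then cycleGap f i j k else 0) - (if j = l then cycleGap f i j k else 0)
      - (if k = l then cycleGap f i j k else 0) := by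
  by_cases hn : [i, j, k].Nodup
  · simp only [List.nodup_cons, List.mem_cons, List.not_mem_nil, or_false, not_or] at hn ⊢
    grind
  · simp [cycleGap, hn]

/-! ### The octopus inequality -/

section ZeroSum

variable (f : Equiv.Perm V → ℝ) {c : V → ℝ}

theorem sum_cycleGap_middle :
    ∑ i, ∑ j, ∑ k, c i * c j * c k * c j * cycleGap f i j k
      = ∑ i, ∑ j, ∑ k, c i * c j * c k * c i * cycleGap f i j k := by
  rw [Finset.sum_comm]
  refine Finset.sum_congr rfl fun i _ => Finset.sum_congr rfl fun j _ =>
    Finset.sum_congr rfl fun k _ => ?_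
  rw [cycleGap_swap_left]
  ring

theorem sum_cycleGap_last :
    ∑ i, ∑ j, ∑ k, c i * c j * c k * c k * cycleGap f i j k
      = ∑ i, ∑ j, ∑ k, c i * c j * c k * c i * cycleGap f i j k := by
  rw [← sum_cycleGap_middle]
  refine Finset.sum_congr rfl fun i _ => ?_
  rw [Finset.sum_comm]
  refine Finset.sum_congr rfl fun j _ => Finset.sum_congr rfl fun k _ => ?_
  rw [cycleGap_swap_right]
  ring

/-- Without the distinctness condition the free index `l` sums to zero; what remains is minus the
three coincidences of `l` with `i`, `j`, `k`, equal by symmetry. -/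
theorem sum_ite_cycleGap (hc : ∑ i, c i = 0) :
    ∑ i, ∑ j, ∑ k, ∑ l, c i * c j * c k * c l *
        (if [i, j, k, l].Nodup then cycleGap f i j k else 0)
      = -3 * ∑ i, ∑ j, ∑ k, c i * c j * c k * c i * cycleGap f i j k := by
  have h0 : ∑ i, ∑ j, ∑ k, ∑ l, c i * c j * c k * c l * cycleGap f i j k = 0 := by
    simp_rw [mul_right_comm _ (c _) (cycleGap _ _ _ _), ← Finset.mul_sum, hc]
    simp
  simp_rw [ite_cycleGap_eq, mul_sub, Finset.sum_sub_distrib]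
  rw [h0]
  simp only [mul_ite, mul_zero, Finset.sum_ite_eq, Finset.mem_univ, if_true]
  rw [sum_cycleGap_middle, sum_cycleGap_last]
  ring

theorem sum_edgeGap :
    ∑ i, ∑ j, ∑ k, ∑ l, c i * c j * c k * c l * edgeGap f i j k l
      = ∑ i, ∑ j, ∑ k, ∑ l, c i * c j * c k * c l * pairGap f i j k l
        + 4 * ∑ i, ∑ j, ∑ k, c i * c j * c k * c i * cycleGap f i j k := by
  have hik : ∑ i, ∑ j, ∑ k, ∑ l, c i * c j * c k * c l * (if i = k then cycleGap f i j l else 0)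
      = ∑ i, ∑ j, ∑ k, c i * c j * c k * c i * cycleGap f i j k := by
    rw [sum_quad_swap_last]
    simp only [mul_ite, mul_zero, Finset.sum_ite_eq, Finset.mem_univ, if_true]
    refine Finset.sum_congr rfl fun i _ => Finset.sum_congr rfl fun j _ =>
      Finset.sum_congr rfl fun k _ => ?_
    ring
  have hjk : ∑ i, ∑ j, ∑ k, ∑ l, c i * c j * c k * c l * (if j = k then cycleGap f i j l else 0)
      = ∑ i, ∑ j, ∑ k, c i * c j * c k * c i * cycleGap f i j k := by
    rw [sum_quad_swap_last, ← sum_cycleGap_middle]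
    simp only [mul_ite, mul_zero, Finset.sum_ite_eq, Finset.mem_univ, if_true]
    refine Finset.sum_congr rfl fun i _ => Finset.sum_congr rfl fun j _ =>
      Finset.sum_congr rfl fun k _ => ?_
    ring
  simp_rw [edgeGap_eq, mul_add, Finset.sum_add_distrib]
  rw [hik, hjk]
  simp only [mul_ite, mul_zero, Finset.sum_ite_eq, Finset.mem_univ, if_true]
  rw [sum_cycleGap_middle]
  ring

theorem quadGap_eq (i j k l : V) :
    quadGap f i j k l = (if [i, j, k, l].Nodup then cycleGap f i j k else 0)
      + (if [i, j, l, k].Nodup then cycleGap f i j l else 0)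
      + (if [i, k, l, j].Nodup then cycleGap f i k l else 0)
      + (if [j, k, l, i].Nodup then cycleGap f j k l else 0)
      - pairGap f i j k l - pairGap f i k j l - pairGap f i l j k := by
  have h1 : [i, j, l, k].Nodup ↔ [i, j, k, l].Nodup := by simp; tauto
  have h2 : [i, k, l, j].Nodup ↔ [i, j, k, l].Nodup := by simp; tauto
  have h3 : [j, k, l, i].Nodup ↔ [i, j, k, l].Nodup := by simp; tauto
  have h4 : [i, k, j, l].Nodup ↔ [i, j, k, l].Nodup := by simp; tauto
  have h5 : [i, l, j, k].Nodup ↔ [i, j, k, l].Nodup := by simp; tauto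
  simp only [quadGap, pairGap, h1, h2, h3, h4, h5]
  by_cases h : [i, j, k, l].Nodup
  · simp only [h, if_true]
  · simp only [h, if_false]
    ring

/-- With C and P the three-cycle and pair sums, the left side is 4(-3C) - 3P, while the sum of
`edgeGap` is P + 4C. -/
theorem sum_quadGap (hc : ∑ i, c i = 0) :
    ∑ i, ∑ j, ∑ k, ∑ l, c i * c j * c k * c l * quadGap f i j k l
      = -3 * ∑ i, ∑ j, ∑ k, ∑ l, c i * c j * c k * c l * edgeGap f i j k l := by
  have t1 : ∑ i, ∑ j, ∑ k, ∑ l, c i * c j * c k * c l *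
        (if [i, j, l, k].Nodup then cycleGap f i j l else 0)
      = ∑ i, ∑ j, ∑ k, ∑ l, c i * c j * c k * c l *
        (if [i, j, k, l].Nodup then cycleGap f i j k else 0) := by
    rw [sum_quad_swap_last]
    simp only [mul_comm, mul_left_comm]
  have t2 : ∑ i, ∑ j, ∑ k, ∑ l, c i * c j * c k * c l *
        (if [i, k, l, j].Nodup then cycleGap f i k l else 0)
      = ∑ i, ∑ j, ∑ k, ∑ l, c i * c j * c k * c l *
        (if [i, j, k, l].Nodup then cycleGap f i j k else 0) := by
    rw [← t1, sum_quad_swap_middle]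
    simp only [mul_comm, mul_left_comm]
  have t3 : ∑ i, ∑ j, ∑ k, ∑ l, c i * c j * c k * c l *
        (if [j, k, l, i].Nodup then cycleGap f j k l else 0)
      = ∑ i, ∑ j, ∑ k, ∑ l, c i * c j * c k * c l *
        (if [i, j, k, l].Nodup then cycleGap f i j k else 0) := by
    rw [← t2, sum_quad_swap_first]
    simp only [mul_comm, mul_left_comm]
  have p1 : ∑ i, ∑ j, ∑ k, ∑ l, c i * c j * c k * c l * pairGap f i k j l
      = ∑ i, ∑ j, ∑ k, ∑ l, c i * c j * c k * c l * pairGap f i j k l := by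
    rw [sum_quad_swap_middle]
    simp only [mul_comm, mul_left_comm]
  have p2 : ∑ i, ∑ j, ∑ k, ∑ l, c i * c j * c k * c l * pairGap f i l j k
      = ∑ i, ∑ j, ∑ k, ∑ l, c i * c j * c k * c l * pairGap f i j k l := by
    rw [← p1, sum_quad_swap_last]
    simp only [mul_comm, mul_left_comm]
  simp_rw [quadGap_eq, mul_sub, Finset.sum_sub_distrib, mul_add, Finset.sum_add_distrib]
  rw [t1, t2, t3, p1, p2, sum_ite_cycleGap f hc, sum_edgeGap]
  ring

theorem sum_edgeGap_add_sum_correlation (hc : ∑ i, c i = 0) :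
    ∑ i, ∑ j, ∑ k, ∑ l, c i * c j * c k * c l * edgeGap f i j k l
      + ∑ i, ∑ j, ∑ k, ∑ l,
          c i * c j * c k * c l * correlation f (Equiv.swap i j * Equiv.swap k l)
      = 2 * (∑ i, c i * c i) * ∑ i, ∑ j, c i * c j * correlation f (Equiv.swap i j) := by
  have hX : ∑ i, ∑ j, c i * c j * (correlation f (Equiv.swap i j) - correlation f 1)
      = ∑ i, ∑ j, c i * c j * correlation f (Equiv.swap i j) := by
    simp_rw [mul_sub, Finset.sum_sub_distrib, ← Finset.sum_mul, ← Finset.mul_sum, hc]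
    simp
  simp_rw [← Finset.sum_add_distrib, ← mul_add, edgeGap_add_correlation, mul_add,
    Finset.sum_add_distrib]
  have h0 : ∑ i, ∑ j, ∑ k, ∑ l, c i * c j * c k * c l * correlation f 1 = 0 := by
    simp_rw [← Finset.sum_mul, ← Finset.mul_sum, hc]
    simp
  have h1 : ∑ i, ∑ j, ∑ k, ∑ l, c i * c j * c k * c l *
        (if i = j then correlation f (Equiv.swap k l) - correlation f 1 else 0)
      = (∑ i, c i * c i) * ∑ i, ∑ j, c i * c j * correlation f (Equiv.swap i j) := by
    rw [← hX, Finset.sum_mul]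
    refine Finset.sum_congr rfl fun i _ => ?_
    rw [Finset.sum_eq_single i (fun j _ hj => by simp [Ne.symm hj]) (by simp)]
    simp only [if_true, mul_assoc, Finset.mul_sum]
  have h2 : ∑ i, ∑ j, ∑ k, ∑ l, c i * c j * c k * c l *
        (if k = l then correlation f (Equiv.swap i j) - correlation f 1 else 0)
      = (∑ i, c i * c i) * ∑ i, ∑ j, c i * c j * correlation f (Equiv.swap i j) := by
    rw [← hX]
    simp only [mul_ite, mul_zero, Finset.sum_ite_eq, Finset.mem_univ, if_true, Finset.mul_sum,
      Finset.sum_mul]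
    refine Finset.sum_congr rfl fun i _ => Finset.sum_congr rfl fun j _ =>
      Finset.sum_congr rfl fun k _ => ?_
    ring
  rw [h0, h1, h2]
  ring

theorem sum_quadGap_nonpos (hc : ∑ i, c i = 0) (o : V) (hpos : ∀ i ≠ o, 0 ≤ c i) :
    ∑ i, ∑ j, ∑ k, ∑ l, c i * c j * c k * c l * quadGap f i j k l ≤ 0 := by
  obtain ⟨S, hS⟩ : ∃ S, S = Finset.univ.erase o := ⟨_, rfl⟩
  have hco : c o = -∑ l ∈ S, c l := by
    rw [← Finset.add_sum_erase _ _ (Finset.mem_univ o), ← hS] at hc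
    linarith
  have hcS : ∀ i ∈ S, 0 ≤ c i := fun i hi => hpos i (by simpa [hS] using hi)
  rw [sum_quad_eq_erase (o := o) _ (fun i j k l => by rw [quadGap_swap_first]; ring)
    (fun i j k l => by rw [quadGap_swap_middle]; ring)
    (fun i j k l => by rw [quadGap_swap_last]; ring) (fun i k l => by simp [quadGap]), ← hS]
  -- Replacing c_o by -∑ c_l makes every term a quadruple sum with nonnegative weights; symmetrising
  -- the factor 4 gives the four terms of `quadGap_le`.
  have t0 : ∑ i ∈ S, ∑ j ∈ S, ∑ k ∈ S, c o * c i * c j * c k * quadGap f o i j k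
      = -∑ i ∈ S, ∑ j ∈ S, ∑ k ∈ S, ∑ l ∈ S, c i * c j * c k * c l * quadGap f o i j k := by
    simp_rw [hco, neg_mul, Finset.sum_neg_distrib, Finset.sum_mul]
    refine congrArg _ (Finset.sum_congr rfl fun i _ => Finset.sum_congr rfl fun j _ =>
      Finset.sum_congr rfl fun k _ => Finset.sum_congr rfl fun l _ => ?_)
    ring
  have t1 : ∑ i ∈ S, ∑ j ∈ S, ∑ k ∈ S, ∑ l ∈ S, c i * c j * c k * c l * quadGap f o i j l
      = ∑ i ∈ S, ∑ j ∈ S, ∑ k ∈ S, ∑ l ∈ S, c i * c j * c k * c l * quadGap f o i j k := by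
    rw [sum_quad_swap_last]
    simp only [mul_comm, mul_left_comm]
  have t2 : ∑ i ∈ S, ∑ j ∈ S, ∑ k ∈ S, ∑ l ∈ S, c i * c j * c k * c l * quadGap f o i k l
      = ∑ i ∈ S, ∑ j ∈ S, ∑ k ∈ S, ∑ l ∈ S, c i * c j * c k * c l * quadGap f o i j k := by
    rw [← t1, sum_quad_swap_middle]
    simp only [mul_comm, mul_left_comm]
  have t3 : ∑ i ∈ S, ∑ j ∈ S, ∑ k ∈ S, ∑ l ∈ S, c i * c j * c k * c l * quadGap f o j k l
      = ∑ i ∈ S, ∑ j ∈ S, ∑ k ∈ S, ∑ l ∈ S, c i * c j * c k * c l * quadGap f o i j k := by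
    rw [← t2, sum_quad_swap_first]
    simp only [mul_comm, mul_left_comm]
  have hnonneg : 0 ≤ ∑ i ∈ S, ∑ j ∈ S, ∑ k ∈ S, ∑ l ∈ S, c i * c j * c k * c l *
      (quadGap f o i j k + quadGap f o i j l + quadGap f o i k l + quadGap f o j k l
        - quadGap f i j k l) := by
    refine Finset.sum_nonneg fun i hi => Finset.sum_nonneg fun j hj =>
      Finset.sum_nonneg fun k hk => Finset.sum_nonneg fun l hl => ?_
    refine mul_nonneg (mul_nonneg (mul_nonneg (mul_nonneg (hcS i hi) (hcS j hj)) (hcS k hk))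
      (hcS l hl)) ?_
    by_cases hn : [i, j, k, l].Nodup
    · rw [sub_nonneg]
      refine quadGap_le f (List.nodup_cons.2 ⟨?_, hn⟩)
      simp only [hS, Finset.mem_erase] at hi hj hk hl
      simp [Ne.symm hi.1, Ne.symm hj.1, Ne.symm hk.1, Ne.symm hl.1]
    -- With a repeated index the left side of `quadGap_le` is zero, but terms on the right may
    -- survive; these are nonnegative.
    · have h0 : quadGap f i j k l = 0 := by rw [quadGap, if_neg hn]
      rw [h0]
      linarith [quadGap_nonneg f o i j k, quadGap_nonneg f o i j l, quadGap_nonneg f o i k l,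
        quadGap_nonneg f o j k l]
  simp_rw [mul_sub, mul_add, Finset.sum_sub_distrib, Finset.sum_add_distrib] at hnonneg
  rw [t1, t2, t3] at hnonneg
  rw [t0]
  linarith

/-- The octopus inequality of Caputo, Liggett and Richthammer. -/
theorem octopus_correlation (hc : ∑ i, c i = 0) (o : V) (hpos : ∀ i ≠ o, 0 ≤ c i) :
    0 ≤ ∑ i, ∑ j, c i * c j * correlation f (Equiv.swap i j) := by
  have hs : 0 ≤ ∑ i, c i * c i := Finset.sum_nonneg fun i _ => mul_self_nonneg _
  rcases hs.eq_or_lt with hs | hs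
  · have h0 : ∀ i, c i = 0 := fun i =>
      mul_self_eq_zero.1 ((Finset.sum_eq_zero_iff_of_nonneg fun i _ => mul_self_nonneg (c i)).1
        hs.symm i (Finset.mem_univ i))
    simp [h0]
  · have h1 := sum_quadGap_nonpos f hc o hpos
    rw [sum_quadGap f hc] at h1
    have h2 := sum_edgeGap_add_sum_correlation f hc
    have h3 := correlation_sum_nonneg f (fun p : V × V => c p.1 * c p.2)
      (fun p => Equiv.swap p.1 p.2)
    simp only [Fintype.sum_prod_type, Equiv.swap_inv, ← mul_assoc] at h3
    refine nonneg_of_mul_nonneg_right (a := 2 * ∑ i, c i * c i) ?_ (by positivity)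
    rw [← h2]
    linarith

end ZeroSum

end MovingParticle

namespace MovingParticle

/-! ### Star-mesh elimination -/

section NetworkReduction

theorem sum_mul_mul_sub_sq {V : Type*} (S : Finset V) (a h : V → ℝ) :
    ∑ i ∈ S, ∑ j ∈ S, a i * a j * (h i - h j) ^ 2
      = 2 * ((∑ i ∈ S, a i) * ∑ i ∈ S, a i * h i ^ 2 - (∑ i ∈ S, a i * h i) ^ 2) := by
  have key (i j : V) : a i * a j * (h i - h j) ^ 2
      = (a i * h i ^ 2) * a j + a i * (a j * h j ^ 2) - 2 * ((a i * h i) * (a j * h j)) := by ring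
  simp_rw [key, Finset.sum_sub_distrib, Finset.sum_add_distrib, ← Finset.mul_sum, ← Finset.sum_mul]
  ring

variable {V : Type*} [Fintype V] [DecidableEq V]

theorem sum_weighted_eq_erase {w D : V → V → ℝ} (hw : ∀ i j, w i j = w j i)
    (hD : ∀ i j, D i j = D j i) (hD0 : ∀ i, D i i = 0) (v : V) :
    ∑ i, ∑ j, w i j * D i j
      = 2 * ∑ j ∈ Finset.univ.erase v, w v j * D v j
        + ∑ i ∈ Finset.univ.erase v, ∑ j ∈ Finset.univ.erase v, w i j * D i j := by
  have hsum (g : V → ℝ) : ∑ i, g i = g v + ∑ i ∈ Finset.univ.erase v, g i :=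
    (Finset.add_sum_erase _ _ (Finset.mem_univ v)).symm
  have hsymm (i : V) : w i v * D i v = w v i * D v i := by rw [hw, hD]
  simp_rw [hsum, Finset.sum_add_distrib, hsymm, hD0]
  ring

/-- The weights obtained from `w` by eliminating the vertex `v`. -/
noncomputable def eliminate (w : V → V → ℝ) (v i j : V) : ℝ :=
  if i = v ∨ j = v then 0
  else w i j + w v i * w v j / ∑ k ∈ Finset.univ.erase v, w v k

/-- Elimination may create loops, harmless where `D` vanishes on the diagonal. If `v` has total
weight zero, division by zero adds no edges. -/
theorem sum_eliminate (w D : V → V → ℝ) (v : V) :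
    ∑ i, ∑ j, eliminate w v i j * D i j
      = ∑ i ∈ Finset.univ.erase v, ∑ j ∈ Finset.univ.erase v, w i j * D i j
        + (∑ i ∈ Finset.univ.erase v, ∑ j ∈ Finset.univ.erase v, w v i * w v j * D i j)
          / ∑ k ∈ Finset.univ.erase v, w v k := by
  have hsum (g : V → ℝ) : ∑ i, g i = g v + ∑ i ∈ Finset.univ.erase v, g i :=
    (Finset.add_sum_erase _ _ (Finset.mem_univ v)).symm
  rw [hsum, Finset.sum_div, ← Finset.sum_add_distrib]
  simp only [eliminate, true_or, if_true, zero_mul, Finset.sum_const_zero, zero_add]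
  refine Finset.sum_congr rfl fun i hi => ?_
  rw [hsum, Finset.sum_div, ← Finset.sum_add_distrib]
  simp only [or_true, if_true, zero_mul, zero_add]
  refine Finset.sum_congr rfl fun j hj => ?_
  rw [if_neg (by simpa using ⟨Finset.ne_of_mem_erase hi, Finset.ne_of_mem_erase hj⟩)]
  ring

/-- The function `D` satisfies the octopus inequality. -/
def IsOctopus (D : V → V → ℝ) : Prop :=
  ∀ (c : V → ℝ) (o : V), ∑ i, c i = 0 → (∀ i ≠ o, 0 ≤ c i) → ∑ i, ∑ j, c i * c j * D i j ≤ 0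

theorem IsOctopus.sum_star_le {D : V → V → ℝ} (hO : IsOctopus D) (hD : ∀ i j, D i j = D j i)
    (hD0 : ∀ i, D i i = 0) (v : V) {a : V → ℝ} (ha : ∀ i, 0 ≤ a i) :
    (∑ i ∈ Finset.univ.erase v, ∑ j ∈ Finset.univ.erase v, a i * a j * D i j)
        / ∑ k ∈ Finset.univ.erase v, a k
      ≤ 2 * ∑ j ∈ Finset.univ.erase v, a j * D v j := by
  obtain ⟨W, hW⟩ : ∃ W, W = ∑ k ∈ Finset.univ.erase v, a k := ⟨_, rfl⟩
  have hW0 : 0 ≤ W := hW ▸ Finset.sum_nonneg fun i _ => ha i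
  have hc (i : V) (hi : i ∈ Finset.univ.erase v) : Function.update a v (-W) i = a i :=
    Function.update_of_ne (Finset.ne_of_mem_erase hi) _ _
  rw [← hW]
  rcases hW0.eq_or_lt with h0 | hpos
  · have hz : ∀ i ∈ Finset.univ.erase v, a i = 0 := by
      rw [← Finset.sum_eq_zero_iff_of_nonneg fun i _ => ha i]
      rw [← hW, h0]
    rw [← h0, div_zero, Finset.sum_eq_zero fun i hi => by rw [hz i hi, zero_mul], mul_zero]
  -- The weight -W at `v` makes the coefficients sum to zero.
  · have h := hO (Function.update a v (-W)) v ?_ ?_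
    · rw [sum_weighted_eq_erase (w := fun i j => _) (fun i j => mul_comm _ _) hD hD0 v] at h
      simp only [Function.update_self] at h
      have e1 : ∑ j ∈ Finset.univ.erase v, -W * Function.update a v (-W) j * D v j
          = -W * ∑ j ∈ Finset.univ.erase v, a j * D v j := by
        rw [Finset.mul_sum]
        refine Finset.sum_congr rfl fun j hj => ?_
        rw [hc j hj, mul_assoc]
      have e2 : ∑ i ∈ Finset.univ.erase v, ∑ j ∈ Finset.univ.erase v,
            Function.update a v (-W) i * Function.update a v (-W) j * D i j
          = ∑ i ∈ Finset.univ.erase v, ∑ j ∈ Finset.univ.erase v, a i * a j * D i j :=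
        Finset.sum_congr rfl fun i hi => Finset.sum_congr rfl fun j hj => by
          rw [hc i hi, hc j hj]
      rw [e1, e2] at h
      rw [div_le_iff₀ hpos]
      linarith
    · rw [← Finset.add_sum_erase _ _ (Finset.mem_univ v), Finset.sum_congr rfl hc, ← hW]
      simp
    · intro i hi
      rw [Function.update_of_ne hi]
      exact ha i

/-- Eliminating all vertices of `B` from a network on `B ∪ {x, y}` gives a potential witnessing the
comparison of the edge `xy` with the network. -/
theorem IsOctopus.exists_potential {D : V → V → ℝ} (hO : IsOctopus D)
    (hD : ∀ i j, D i j = D j i) (hD0 : ∀ i, D i i = 0) {x y : V} (hxy : x ≠ y) (hDxy : 0 ≤ D x y)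
    (B : Finset V) (hxB : x ∉ B) (hyB : y ∉ B) :
    ∀ w : V → V → ℝ, (∀ i j, w i j = w j i) → (∀ i j, 0 ≤ w i j) →
      (∀ i j, w i j ≠ 0 → i ∈ B ∨ i = x ∨ i = y) →
      ∃ h : V → ℝ, h x = 1 ∧ h y = 0 ∧
        (∑ i, ∑ j, w i j * (h i - h j) ^ 2) * D x y ≤ ∑ i, ∑ j, w i j * D i j := by
  have hsq (h : V → ℝ) (i j : V) : (h i - h j) ^ 2 = (h j - h i) ^ 2 := by ring
  induction B using Finset.induction_on with
  | empty =>
    intro w hw hw0 hsupp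
    -- Only the edge `xy` (and loops) can carry weight, so both sides equal 2 w(x,y) D(x,y).
    refine ⟨Pi.single x 1, by simp, by simp [hxy.symm], le_of_eq ?_⟩
    rw [sum_weighted_eq_erase hw hD hD0 x,
      sum_weighted_eq_erase hw (D := fun i j => _) (hsq (Pi.single x 1)) (by simp) x]
    have key (E : V → V → ℝ) (hE : ∀ i, E i i = 0) :
        2 * ∑ j ∈ Finset.univ.erase x, w x j * E x j
          + ∑ i ∈ Finset.univ.erase x, ∑ j ∈ Finset.univ.erase x, w i j * E i j
        = 2 * (w x y * E x y) := by
      rw [Finset.sum_eq_single y, Finset.sum_eq_zero, add_zero]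
      · intro i hi
        refine Finset.sum_eq_zero fun j hj => ?_
        by_cases h1 : w i j = 0
        · rw [h1, zero_mul]
        · have h2 : w j i ≠ 0 := by rwa [hw]
          have hi' := hsupp _ _ h1
          have hj' := hsupp _ _ h2
          simp only [Finset.notMem_empty, Finset.ne_of_mem_erase hi, Finset.ne_of_mem_erase hj,
            false_or] at hi' hj'
          rw [hi', hj', hE, mul_zero]
      · intro j hj hjy
        by_contra h1
        have h2 : w j x ≠ 0 := by
          rw [hw]
          exact left_ne_zero_of_mul h1
        have hj' := hsupp _ _ h2
        simp [Finset.ne_of_mem_erase hj, hjy] at hj'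
      · simp [hxy.symm]
    have hsingle := key (fun i j =>
      ((Pi.single x 1 : V → ℝ) i - (Pi.single x 1 : V → ℝ) j) ^ 2) (by simp)
    beta_reduce at hsingle
    rw [key D hD0, hsingle]
    simp [hxy.symm, mul_assoc]
  | insert v B hv ih =>
    intro w hw hw0 hsupp
    have hvx : x ≠ v := fun h => hxB (h ▸ Finset.mem_insert_self _ _)
    have hvy : y ≠ v := fun h => hyB (h ▸ Finset.mem_insert_self _ _)
    obtain ⟨W, hW⟩ : ∃ W, W = ∑ k ∈ Finset.univ.erase v, w v k := ⟨_, rfl⟩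
    have hW0 : 0 ≤ W := hW ▸ Finset.sum_nonneg fun i _ => hw0 v i
    obtain ⟨h, hx, hy, hle⟩ := ih (fun h => hxB (Finset.mem_insert_of_mem h))
      (fun h => hyB (Finset.mem_insert_of_mem h)) (eliminate w v)
      (fun i j => by simp only [eliminate, or_comm, hw i j, mul_comm])
      (fun i j => by
        unfold eliminate
        split_ifs
        · exact le_rfl
        · exact add_nonneg (hw0 _ _) (div_nonneg (mul_nonneg (hw0 _ _) (hw0 _ _)) (hW ▸ hW0)))
      (fun i j hij => by
        unfold eliminate at hij
        split_ifs at hij with hv'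
        · exact absurd rfl hij
        · push Not at hv'
          by_cases h1 : w i j = 0
          · have h2 : w i v ≠ 0 := by
              intro h2
              rw [hw v i, h1, h2] at hij
              simp at hij
            simpa [hv'.1] using hsupp i v h2
          · simpa [hv'.1] using hsupp i j h1)
    -- The harmonic value at `v`, the weighted mean of `h`: the star's energy then equals that of
    -- the mesh, by the variance identity `sum_mul_mul_sub_sq`.
    refine ⟨Function.update h v ((∑ k ∈ Finset.univ.erase v, w v k * h k) / W),
      by rw [Function.update_of_ne hvx, hx], by rw [Function.update_of_ne hvy, hy], ?_⟩
    have hD' : ∑ i, ∑ j, eliminate w v i j * D i j ≤ ∑ i, ∑ j, w i j * D i j := by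
      rw [sum_eliminate, sum_weighted_eq_erase hw hD hD0 v]
      linarith [hO.sum_star_le hD hD0 v (hw0 v)]
    refine le_trans (mul_le_mul_of_nonneg_right (le_of_eq ?_) hDxy) (hle.trans hD')
    rw [sum_eliminate,
      sum_weighted_eq_erase hw (D := fun i j => _) (hsq (Function.update h v _)) (by simp) v,
      sum_mul_mul_sub_sq, ← hW, add_comm]
    congr 1
    · refine Finset.sum_congr rfl fun i hi => Finset.sum_congr rfl fun j hj => ?_
      rw [Function.update_of_ne (Finset.ne_of_mem_erase hi),
        Function.update_of_ne (Finset.ne_of_mem_erase hj)]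
    · have e : ∑ j ∈ Finset.univ.erase v, w v j *
            (Function.update h v ((∑ k ∈ Finset.univ.erase v, w v k * h k) / W) v
              - Function.update h v ((∑ k ∈ Finset.univ.erase v, w v k * h k) / W) j) ^ 2
          = ∑ j ∈ Finset.univ.erase v, w v j *
            ((∑ k ∈ Finset.univ.erase v, w v k * h k) / W - h j) ^ 2 := by
        refine Finset.sum_congr rfl fun j hj => ?_
        rw [Function.update_self, Function.update_of_ne (Finset.ne_of_mem_erase hj)]
      rw [e]
      rcases hW0.eq_or_lt with h0 | hpos
      · have hz : ∀ i ∈ Finset.univ.erase v, w v i = 0 := by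
          rw [← Finset.sum_eq_zero_iff_of_nonneg fun i _ => hw0 v i, ← hW, h0]
        rw [← h0, div_zero, div_zero, Finset.sum_eq_zero fun i hi => by rw [hz i hi, zero_mul],
          mul_zero]
      · obtain ⟨M, hM⟩ : ∃ M, M = ∑ k ∈ Finset.univ.erase v, w v k * h k := ⟨_, rfl⟩
        have key (j : V) : w v j * (M / W - h j) ^ 2
            = w v j * (M / W) ^ 2 - 2 * (M / W) * (w v j * h j) + w v j * h j ^ 2 := by ring
        rw [← hM]
        simp_rw [key, Finset.sum_add_distrib, Finset.sum_sub_distrib, ← Finset.mul_sum,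
          ← Finset.sum_mul]
        rw [← hM, ← hW]
        field_simp
        ring

end NetworkReduction

/-! ### Edge sums and finiteness of the resistance -/

section Graph

variable {V : Type*} [Fintype V] [DecidableEq V] (G : SimpleGraph V) [DecidableRel G.Adj]

/-- The conductance matrix. -/
def weight (c : Sym2 V → ℝ) (i j : V) : ℝ := if G.Adj i j then c s(i, j) else 0

theorem two_mul_sum_edgeFinset (F : Sym2 V → ℝ) :
    2 * ∑ e ∈ G.edgeFinset, F e = ∑ i, ∑ j, if G.Adj i j then F s(i, j) else 0 := by
  have h1 : ∑ d : G.Dart, F d.edge = 2 * ∑ e ∈ G.edgeFinset, F e := by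
    rw [← Finset.sum_fiberwise_of_maps_to (t := G.edgeFinset) (g := fun d : G.Dart => d.edge)
      (fun d _ => by simp), Finset.mul_sum]
    refine Finset.sum_congr rfl fun e he => ?_
    rw [Finset.sum_congr rfl (g := fun _ => F e) fun d hd => by rw [(Finset.mem_filter.1 hd).2],
      Finset.sum_const, G.dart_edge_fiber_card e (by simpa using he)]
    simp
  rw [← h1, ← Fintype.sum_prod_type' (f := fun i j => if G.Adj i j then F s(i, j) else 0),
    ← Finset.sum_filter]
  refine Finset.sum_bij (fun d _ => d.toProd) ?_ ?_ ?_ ?_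
  · simp
  · intro d _ d' _ h
    exact SimpleGraph.Dart.ext _ _ h
  · intro p hp
    exact ⟨⟨p, by simpa using hp⟩, by simp, rfl⟩
  · intro d _
    rfl

theorem two_mul_sum_edges (c : Sym2 V → ℝ) (D : V → V → ℝ) (hD : ∀ i j, D i j = D j i) :
    2 * ∑ e ∈ G.edgeFinset, c e * Sym2.lift ⟨D, hD⟩ e = ∑ i, ∑ j, weight G c i j * D i j := by
  rw [two_mul_sum_edgeFinset]
  simp [weight]

theorem electricEnergy_nonneg {c : Sym2 V → ℝ} (hc : ∀ e ∈ G.edgeSet, 0 ≤ c e) (h : V → ℝ) :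
    0 ≤ electricEnergy G c h := by
  refine Finset.sum_nonneg fun e he => mul_nonneg (hc e (by simpa using he)) ?_
  induction e with
  | _ a b => simpa using sq_nonneg (h a - h b)

theorem exists_sq_le_electricEnergy {c : Sym2 V → ℝ} (hc : ∀ e ∈ G.edgeSet, 0 ≤ c e) {x y : V}
    (p : G.Walk x y) (hp : ∀ e ∈ p.edges, 0 < c e) :
    ∃ K : ℝ, ∀ h : V → ℝ, (h x - h y) ^ 2 ≤ K * electricEnergy G c h := by
  induction p with
  | nil => exact ⟨0, by simp⟩
  | @cons u v w huv p ih =>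
    obtain ⟨K, hK⟩ := ih fun e he => hp e (by simp [he])
    have hcuv : 0 < c s(u, v) := hp _ (by simp)
    -- From (a + b)² ≤ 2a² + 2b², splitting off the first edge of the walk.
    refine ⟨2 / c s(u, v) + 2 * K, fun h => ?_⟩
    have hedge : c s(u, v) * (h u - h v) ^ 2 ≤ electricEnergy G c h := by
      refine Finset.single_le_sum (s := G.edgeFinset) (a := s(u, v))
        (f := fun e => c e * Sym2.lift ⟨fun z w => (h z - h w) ^ 2, fun z w => by ring⟩ e)
        (fun e he => mul_nonneg (hc e (by simpa using he)) ?_) (by simpa using huv)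
      induction e with
      | _ a b => simpa using sq_nonneg (h a - h b)
    have h1 : (h u - h v) ^ 2 ≤ electricEnergy G c h / c s(u, v) := by
      rw [le_div_iff₀ hcuv]
      linarith
    calc (h u - h w) ^ 2 ≤ 2 * (h u - h v) ^ 2 + 2 * (h v - h w) ^ 2 := by
          nlinarith [sq_nonneg ((h u - h v) - (h v - h w))]
      _ ≤ 2 * (electricEnergy G c h / c s(u, v)) + 2 * (K * electricEnergy G c h) := by
          gcongr
          exact hK h
      _ = _ := by ring

theorem effectiveResistance_ne_top {c : Sym2 V → ℝ} (hc : ∀ e ∈ G.edgeSet, 0 ≤ c e) {x y : V}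
    (p : G.Walk x y) (hp : ∀ e ∈ p.edges, 0 < c e) : effectiveResistance G c x y ≠ ∞ := by
  obtain ⟨K, hK⟩ := exists_sq_le_electricEnergy G hc p hp
  rw [effectiveResistance, ENNReal.inv_ne_top, ← pos_iff_ne_zero]
  -- Every admissible potential has energy at least this bound; |K| + 1 replaces K, whose sign is
  -- not known.
  refine lt_of_lt_of_le (b := ENNReal.ofReal (|K| + 1)⁻¹)
    (by rw [ENNReal.ofReal_pos]; positivity) (le_iInf₂ fun h hh => ENNReal.ofReal_le_ofReal ?_)
  have h1 := hK h
  rw [hh.1, hh.2] at h1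
  have hE := electricEnergy_nonneg G hc h
  rw [inv_le_iff_one_le_mul₀ (by positivity)]
  nlinarith [le_abs_self K]

end Graph

/-! ### The interchange process as a network energy -/

section Interchange

variable {V : Type*} [Fintype V] [DecidableEq V]

/-- The unnormalised Dirichlet form `∑ η, (∇_{xy} f)(η)² / 2` of a transposition. -/
def swapEnergy (f : Equiv.Perm V → ℝ) (x y : V) : ℝ :=
  correlation f 1 - correlation f (Equiv.swap x y)

theorem swapEnergy_comm (f : Equiv.Perm V → ℝ) (x y : V) : swapEnergy f x y = swapEnergy f y x := by
  rw [swapEnergy, swapEnergy, Equiv.swap_comm]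

theorem swapEnergy_self (f : Equiv.Perm V → ℝ) (x : V) : swapEnergy f x x = 0 := by
  rw [swapEnergy, Equiv.swap_self]
  exact sub_self _

theorem uniformMean_swapDiff_sq (f : Equiv.Perm V → ℝ) (x y : V) :
    1 / 2 * uniformMean (fun η => swapDiff x y f η ^ 2)
      = swapEnergy f x y / Fintype.card (Equiv.Perm V) := by
  have h (η : Equiv.Perm V) : swapDiff x y f η ^ 2
      = f (η * Equiv.swap x y) * f (η * Equiv.swap x y) + f (η * 1) * f (η * 1)
        - 2 * (f η * f (η * Equiv.swap x y)) := by
    rw [swapDiff, mul_one]; ring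
  simp_rw [uniformMean, Fintype.expect_eq_sum_div_card, h, Finset.sum_sub_distrib,
    Finset.sum_add_distrib, sum_mul_eq_correlation, ← Finset.mul_sum]
  rw [swapEnergy, inv_mul_cancel, inv_mul_cancel, ← correlation]
  ring

theorem interchangeEnergy_eq (G : SimpleGraph V) [DecidableRel G.Adj] (c : Sym2 V → ℝ)
    (f : Equiv.Perm V → ℝ) :
    2 * interchangeEnergy G c f
      = (∑ i, ∑ j, weight G c i j * swapEnergy f i j) / Fintype.card (Equiv.Perm V) := by
  rw [← two_mul_sum_edges G c _ (swapEnergy_comm f), mul_div_assoc, interchangeEnergy, uniformMean,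
    Fintype.expect_eq_sum_div_card]
  congr 2
  simp_rw [interchangeGenerator, ← Finset.sum_neg_distrib, Finset.mul_sum]
  rw [Finset.sum_comm]
  refine Finset.sum_congr rfl fun e _ => ?_
  induction e with
  | _ a b =>
    simp only [Sym2.lift_mk, swapDiff, swapEnergy, correlation, ← Finset.sum_sub_distrib,
      Finset.mul_sum]
    refine Finset.sum_congr rfl fun η _ => ?_
    rw [mul_one]
    ring

theorem isOctopus_swapEnergy (f : Equiv.Perm V → ℝ) : IsOctopus (swapEnergy f) := by
  intro c o hc hpos
  have h := octopus_correlation f hc o hpos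
  simp_rw [swapEnergy, mul_sub, Finset.sum_sub_distrib, ← Finset.sum_mul, ← Finset.mul_sum, hc]
  simpa using h

end Interchange

end MovingParticle

/-! ### The comparison with effective resistance -/

open MovingParticle in
theorem lemma3p2 {V : Type*} [Fintype V] [DecidableEq V] (G : SimpleGraph V)
    [DecidableRel G.Adj] (c : Sym2 V → ℝ) (hc : ∀ e ∈ G.edgeSet, 0 ≤ c e) (x y : V)
    (hxy : ∃ p : G.Walk x y, ∀ e ∈ p.edges, 0 < c e) (f : Equiv.Perm V → ℝ) :
    MovingParticle.effectiveResistance G c x y ≠ ∞ ∧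
      (1 / 2 : ℝ) * MovingParticle.uniformMean (fun η => MovingParticle.swapDiff x y f η ^ 2) ≤
        (MovingParticle.effectiveResistance G c x y).toReal * MovingParticle.interchangeEnergy G c f := by
  obtain ⟨p, hp⟩ := hxy
  have htop := effectiveResistance_ne_top G hc p hp
  refine ⟨htop, ?_⟩
  rcases eq_or_ne x y with rfl | hne
  · have h0 : effectiveResistance G c x x = 0 := by
      rw [effectiveResistance, ENNReal.inv_eq_zero, iInf₂_eq_top]
      intro h hh
      exact absurd (hh.1.symm.trans hh.2) one_ne_zero
    rw [h0, uniformMean_swapDiff_sq, swapEnergy_self]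
    simp
  have hN : (0 : ℝ) < Fintype.card (Equiv.Perm V) := by exact_mod_cast Fintype.card_pos
  have hDxy : 0 ≤ swapEnergy f x y := by
    have h1 := uniformMean_swapDiff_sq f x y
    have h2 : 0 ≤ uniformMean (fun η => swapDiff x y f η ^ 2) :=
      Finset.expect_nonneg fun η _ => sq_nonneg _
    have h3 : 0 ≤ swapEnergy f x y / Fintype.card (Equiv.Perm V) := by linarith
    simpa [hN.ne'] using mul_nonneg h3 hN.le
  obtain ⟨h, hx, hy, hle⟩ := (isOctopus_swapEnergy f).exists_potential (swapEnergy_comm f)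
    (swapEnergy_self f) hne hDxy ((Finset.univ.erase x).erase y) (by simp) (by simp) (weight G c)
    (fun i j => by simp only [weight, G.adj_comm, Sym2.eq_swap])
    (fun i j => by
      unfold weight
      split_ifs with hij
      · exact hc _ hij
      · exact le_rfl)
    (fun i _ _ => by simp; tauto)
  have hE : 2 * electricEnergy G c h = ∑ i, ∑ j, weight G c i j * (h i - h j) ^ 2 :=
    two_mul_sum_edges G c (fun i j => (h i - h j) ^ 2) _
  have hI := interchangeEnergy_eq G c f
  rw [← hE] at hle
  have hmain : electricEnergy G c h * (1 / 2 * uniformMean (fun η => swapDiff x y f η ^ 2))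
      ≤ interchangeEnergy G c f := by
    rw [uniformMean_swapDiff_sq, ← mul_div_assoc, div_le_iff₀ hN]
    rw [eq_div_iff hN.ne'] at hI
    linarith
  -- Admissibility of `h` suffices here; it need not be identified as the minimiser.
  have hR : 1 ≤ (effectiveResistance G c x y).toReal * electricEnergy G c h := by
    have hinf : (effectiveResistance G c x y)⁻¹ ≤ ENNReal.ofReal (electricEnergy G c h) := by
      rw [effectiveResistance, inv_inv]
      exact iInf₂_le h ⟨hx, hy⟩
    have hR0 : effectiveResistance G c x y ≠ 0 := by
      intro h0
      simp [h0] at hinf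
    have h1 : 1 ≤ effectiveResistance G c x y * ENNReal.ofReal (electricEnergy G c h) := by
      rw [← ENNReal.mul_inv_cancel hR0 htop]
      gcongr
    have h2 := ENNReal.toReal_mono (ENNReal.mul_ne_top htop ENNReal.ofReal_ne_top) h1
    rwa [ENNReal.toReal_one, ENNReal.toReal_mul,
      ENNReal.toReal_ofReal (electricEnergy_nonneg G hc h)] at h2
  have hnn : 0 ≤ 1 / 2 * uniformMean (fun η => swapDiff x y f η ^ 2) := by
    rw [uniformMean_swapDiff_sq]
    positivity
  calc 1 / 2 * uniformMean (fun η => swapDiff x y f η ^ 2)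
      ≤ ((effectiveResistance G c x y).toReal * electricEnergy G c h)
        * (1 / 2 * uniformMean (fun η => swapDiff x y f η ^ 2)) :=
        le_mul_of_one_le_left hnn hR
    _ = (effectiveResistance G c x y).toReal * (electricEnergy G c h
        * (1 / 2 * uniformMean (fun η => swapDiff x y f η ^ 2))) := by ring
    _ ≤ _ := mul_le_mul_of_nonneg_left hmain ENNReal.toReal_nonneg
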